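/- **Rapid mixing for commuting RFTS.** Let $|\psi^{(s)}\rangle$, $s\in\mathbb N$, be a scalable family of pure states: $|\psi^{(s)}\rangle$ is a unit vector in $\mathcal H^{(s)}=\bigotimes_{j=1}^{N^{(s)}}\mathbb C^{d}$, where $N^{(s)}$ is monotonically increasing and unbounded in $s$, and $\mathcal H^{(s)}$ carries a neighborhood structure, that is, a list of sets of subsystems $\mathcal N^{(s)}_k\subseteq\{1,\dots,N^{(s)}\}$, $k=1,\dots,K^{(s)}$, such that for some constants $b,B>0$ one has $K^{(s)}\le b\,N^{(s)}$ and $\dim\mathcal H_{\mathcal N^{(s)}_k}\le B$ for all $k,s$. Suppose that for every $s$ the state $\rho^{(s)}=|\psi^{(s)}\rangle\langle\psi^{(s)}|$ is made robustly finite-time stable (RFTS) by mutually commuting neighborhood maps $\mathcal E^{(s)}_k$, $k=1,\dots,K^{(s)}$: each $\mathcal E_k^{(s)}$ is a completely positive trace-preserving (CPTP) map that acts as the identity outside $\mathcal N^{(s)}_k$ and satisfies $\mathcal E^{(s)}_k(\rho^{(s)})=\rho^{(s)}$, and the composition of all these maps, in any order, sends every density operator to $\rho^{(s)}$. Assume that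 there is $\nu>0$ such that every eigenvalue $\lambda$ of every $\mathcal E^{(s)}_k$ satisfies $\lambda=1$ or $|\lambda|<1-\nu$. Put $\mathcal L^{(s)}=\sum_k(\mathcal E^{(s)}_k-\mathcal I)$. Then: 1. The $\mathcal L^{(s)}$ are quasi-local Liouvillians of bounded norm: there is a constant $C$, independent of $s$, such that each $\mathcal L^{(s)}$ is a sum over $k$ of generators $\mathcal L^{(s)}_{\mathcal N_k}\otimes\mathcal I$ with $\mathcal L^{(s)}_{\mathcal N_k}$ of Gorini–Kossakowski–Sudarshan–Lindblad form on the subsystems in $\mathcal N^{(s)}_k$ and with trace-norm-induced operator norm at most $C$. 2. They are rapidly mixing with respect to $|\psi^{(s)}\rangle$: the maps $e^{\mathcal L^{(s)}t}$, $t\ge0$, are CPTP; $\rho^{(s)}$ is the unique equilibrium state, and the spectral projection $\mathcal E_\phi^{(s)}$ of $\mathcal L^{(s)}$ onto the eigenvalues of zero real part is $X\mapsto \mathrm{tr}(X)\,\rho^{(s)}$; and there is a constant $c>0$ such that for all $s$ and all $t\ge0$ the contraction coefficient satisfies $$\eta\big(e^{\mathcal L^{(s)}t}\big):=\tfrac12\sup_{\rho\ge0,\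 \mathrm{tr}\rho=1}\big\|(\mathcal I-\mathcal E^{(s)}_\phi)\,e^{\mathcal L^{(s)}t}(\rho)\big\|_1\ \le\ c\,N^{(s)}e^{-\nu t}.$$ -/

import Mathlib

open scoped ComplexOrder

noncomputable section

namespace QLMixing

/-! ### States, channels and generators on a finite-dimensional Hilbert space `ℂ^n` -/

section General

/-- Linear maps on the space of operators (superoperators) on `ℂ^n`. -/
abbrev SuperOp (n : Type) : Type := Module.End ℂ (Matrix n n ℂ)

/-- Density operators: positive semidefinite and of unit trace. -/
def IsDensity {n : Type} [Fintype n] (ρ : Matrix n n ℂ) : Prop :=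
  ρ.PosSemidef ∧ ρ.trace = 1

/-- The rank-one operator `|ψ⟩⟨ψ|`. -/
def pureState {n : Type} [Fintype n] (ψ : EuclideanSpace ℂ n) : Matrix n n ℂ :=
  Matrix.of fun x y => ψ x * star (ψ y)

/-- The trace norm `‖A‖₁ = tr √(A† A)`, the sum of the singular values of `A`. -/
def traceNorm {n : Type} [Fintype n] [DecidableEq n] (A : Matrix n n ℂ) : ℝ :=
  ∑ i, √((Matrix.isHermitian_conjTranspose_mul_self A).eigenvalues i)

/-- The map `id_k ⊗ Φ` on `k × k` block matrices with blocks in `B(ℂ^n)`. -/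
def ampliation {n : Type} (k : ℕ) (Φ : SuperOp n)
    (X : Matrix (Fin k × n) (Fin k × n) ℂ) : Matrix (Fin k × n) (Fin k × n) ℂ :=
  Matrix.of fun p q => Φ (Matrix.of fun x y => X (p.1, x) (q.1, y)) p.2 q.2

/-- Completely positive trace-preserving maps. -/
def IsCPTP {n : Type} [Fintype n] (Φ : SuperOp n) : Prop :=
  (∀ (k : ℕ) (X : Matrix (Fin k × n) (Fin k × n) ℂ),
    X.PosSemidef → (ampliation k Φ X).PosSemidef) ∧
  ∀ X : Matrix n n ℂ, (Φ X).trace = X.trace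

/-- Liouvillians: generators of Gorini-Kossakowski-Sudarshan-Lindblad form
`X ↦ -i[H, X] + ∑ j, (L_j X L_j† - ½ {L_j† L_j, X})`. -/
def IsLiouvillian {n : Type} [Fintype n] (G : SuperOp n) : Prop :=
  ∃ (H : Matrix n n ℂ) (m : ℕ) (L : Fin m → Matrix n n ℂ), H.IsHermitian ∧
    ∀ X : Matrix n n ℂ, G X = -Complex.I • (H * X - X * H) +
      ∑ j, (L j * X * (L j).conjTranspose -
        (1 / 2 : ℂ) • ((L j).conjTranspose * L j * X + X * ((L j).conjTranspose * L j)))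

/-- The semigroup `e^{tG}`; the exponential is that of the matrix of `t G` in the standard basis
of the operator space. -/
def semigroup {n : Type} [Fintype n] [DecidableEq n] (G : SuperOp n) (t : ℝ) : SuperOp n :=
  (LinearMap.toMatrixAlgEquiv (Matrix.stdBasis ℂ n n)).symm
    (NormedSpace.exp ((t : ℂ) • LinearMap.toMatrixAlgEquiv (Matrix.stdBasis ℂ n n) G))

/-- The sum of the (generalized) eigenspaces of `G` for the eigenvalues with zero real part. -/
def peripheralSpace {n : Type} (G : SuperOp n) : Submodule ℂ (Matrix n n ℂ) :=
  ⨆ μ ∈ {μ : ℂ | μ.re = 0}, G.maxGenEigenspace μ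

/-- The sum of the (generalized) eigenspaces of `G` for the other eigenvalues. -/
def nonperipheralSpace {n : Type} (G : SuperOp n) : Submodule ℂ (Matrix n n ℂ) :=
  ⨆ μ ∈ {μ : ℂ | μ.re ≠ 0}, G.maxGenEigenspace μ

theorem isCompl_peripheralSpace {n : Type} [Fintype n] (G : SuperOp n) :
    IsCompl (peripheralSpace G) (nonperipheralSpace G) := by
  constructor
  · refine (Module.End.independent_maxGenEigenspace G).disjoint_biSup_biSup ?_
    rw [Set.disjoint_left]
    intro μ h1 h2
    exact h2 h1
  · rw [codisjoint_iff, eq_top_iff, ← Module.End.iSup_maxGenEigenspace_eq_top G]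
    refine iSup_le fun μ => ?_
    by_cases h : μ.re = 0
    · exact le_sup_of_le_left (le_iSup₂_of_le μ h le_rfl)
    · exact le_sup_of_le_right (le_iSup₂_of_le μ h le_rfl)

/-- The spectral projection `E_φ` of the generator `G` onto its peripheral part. -/
def peripheralProj {n : Type} [Fintype n] (G : SuperOp n) : SuperOp n :=
  Submodule.projection (peripheralSpace G) (nonperipheralSpace G) (isCompl_peripheralSpace G)

/-- The contraction coefficient `η(e^{tG}) = ½ sup_ρ ‖(I - E_φ)(e^{tG}(ρ))‖₁`, the supremum being
over all density operators (a compact set, so that the supremum is finite). -/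
def contractionCoeff {n : Type} [Fintype n] [DecidableEq n] (G : SuperOp n) (t : ℝ) : ℝ :=
  (1 / 2) * sSup {r : ℝ | ∃ ρ : Matrix n n ℂ, IsDensity ρ ∧
    r = traceNorm (semigroup G t ρ - peripheralProj G (semigroup G t ρ))}

/-- `ρ` is the unique equilibrium state of `G`, and `G` has no other peripheral part: the
peripheral projection is `X ↦ tr(X) ρ`. -/
structure IsUniqueEquilibrium {n : Type} [Fintype n] (G : SuperOp n) (ρ : Matrix n n ℂ) :
    Prop where
  stationary : G ρ = 0
  unique : ∀ σ : Matrix n n ℂ, IsDensity σ → G σ = 0 → σ = ρ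
  peripheral : ∀ X : Matrix n n ℂ, peripheralProj G X = X.trace • ρ

end General

/-! ### Multipartite systems and quasi-locality -/

section Multipartite

/-- Basis labels of `⨂_{i < N} ℂ^d`. -/
abbrev Config (N d : ℕ) : Type := Fin N → Fin d

/-- Basis labels of `⨂_{i ∈ S} ℂ^d` for a set `S` of subsystems. -/
abbrev LocalConfig {N : ℕ} (d : ℕ) (S : Finset (Fin N)) : Type := {i // i ∈ S} → Fin d

/-- The label that agrees with `a` on `S` and with `z` outside `S`. -/
def glue {N d : ℕ} (S : Finset (Fin N)) (a : LocalConfig d S) (z : Config N d) : Config N d :=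
  fun i => if h : i ∈ S then a ⟨i, h⟩ else z i

/-- The map `Φ ⊗ id` on the whole system, where `Φ` acts on the subsystems in `S` and the identity
map on the operators of the other ones. -/
def extend {N d : ℕ} (S : Finset (Fin N)) (Φ : SuperOp (LocalConfig d S)) :
    SuperOp (Config N d) where
  toFun X := Matrix.of fun x y =>
    Φ (Matrix.of fun a b => X (glue S a x) (glue S b y)) (fun i => x i) (fun i => y i)
  map_add' X Y := by
    ext x y
    exact congrFun (congrFun (map_add Φ (Matrix.of fun a b => X (glue S a x) (glue S b y))
      (Matrix.of fun a b => Y (glue S a x) (glue S b y))) _) _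
  map_smul' c X := by
    ext x y
    exact congrFun (congrFun
      (map_smul Φ c (Matrix.of fun a b => X (glue S a x) (glue S b y))) _) _

/-- CPTP maps of the form `E_S ⊗ id`. -/
def IsNeighborhoodMap {N d : ℕ} (S : Finset (Fin N)) (E : SuperOp (Config N d)) : Prop :=
  ∃ Φ : SuperOp (LocalConfig d S), IsCPTP Φ ∧ E = extend S Φ

/-- Generators of the form `L_S ⊗ id` with `L_S` a Liouvillian on the subsystems in `S`. -/
def IsNeighborhoodLiouvillian {N d : ℕ} (S : Finset (Fin N)) (G : SuperOp (Config N d)) : Prop :=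
  ∃ Γ : SuperOp (LocalConfig d S), IsLiouvillian Γ ∧ G = extend S Γ

/-- `G` is a quasi-local Liouvillian `∑ k, L_k`, each `L_k` being a neighborhood Liouvillian on the
`k`-th neighborhood whose norm, as an operator on the trace class, is at most `C`. -/
def IsBoundedQLLiouvillian {N d K : ℕ} (nbhd : Fin K → Finset (Fin N)) (C : ℝ)
    (G : SuperOp (Config N d)) : Prop :=
  ∃ L : Fin K → SuperOp (Config N d), G = ∑ k, L k ∧ ∀ k,
    IsNeighborhoodLiouvillian (nbhd k) (L k) ∧
    ∀ X : Matrix (Config N d) (Config N d) ℂ, traceNorm (L k X) ≤ C * traceNorm X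

/-- The pure state `ψ` is made robustly finite-time stable by the maps `E_k`, one for each
neighborhood: each map is a neighborhood map leaving `|ψ⟩⟨ψ|` invariant, and composing all of them,
in any order, sends every state to `|ψ⟩⟨ψ|`. -/
structure MadeRFTSBy {N d K : ℕ} (nbhd : Fin K → Finset (Fin N))
    (ψ : EuclideanSpace ℂ (Config N d)) (E : Fin K → SuperOp (Config N d)) : Prop where
  neighborhoodMap : ∀ k, IsNeighborhoodMap (nbhd k) (E k)
  invariant : ∀ k, E k (pureState ψ) = pureState ψ
  attractive : ∀ (π : Equiv.Perm (Fin K)) (σ : Matrix (Config N d) (Config N d) ℂ),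
    IsDensity σ → (List.ofFn fun k => E (π k)).prod σ = pureState ψ

/-- A scalable family of pure states with neighborhood structures. The neighborhood structure at
`s` is a list of `K s` sets of subsystems. -/
structure ScalableFamily where
  /-- the dimension of each subsystem -/
  d : ℕ
  /-- the number of subsystems -/
  N : ℕ → ℕ
  N_monotone : Monotone N
  N_unbounded : ∀ m, ∃ s, m ≤ N s
  /-- the states -/
  ψ : (s : ℕ) → EuclideanSpace ℂ (Config (N s) d)
  norm_ψ : ∀ s, ‖ψ s‖ = 1
  /-- the number of neighborhoods -/
  K : ℕ → ℕ
  /-- the neighborhoods -/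
  nbhd : (s : ℕ) → Fin (K s) → Finset (Fin (N s))
  card_nbhds : ∃ b : ℝ, 0 < b ∧ ∀ s, (K s : ℝ) ≤ b * N s
  dim_nbhd : ∃ B : ℕ, 0 < B ∧ ∀ s k, d ^ (nbhd s k).card ≤ B

/-- The family of semigroups generated by `G s` consists of CPTP maps and is rapidly mixing with
respect to the states of the family, with the constants `c`, `δ`, `γ`:
`η(e^{t G s}) ≤ c (N s)^δ e^{-γ t}` for all `t ≥ 0`. -/
structure IsRapidlyMixing (F : ScalableFamily) (G : (s : ℕ) → SuperOp (Config (F.N s) F.d))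
    (c δ γ : ℝ) : Prop where
  c_pos : 0 < c
  δ_pos : 0 < δ
  γ_pos : 0 < γ
  cptp : ∀ s t, 0 ≤ t → IsCPTP (semigroup (G s) t)
  equilibrium : ∀ s, IsUniqueEquilibrium (G s) (pureState (F.ψ s))
  bound : ∀ s t, 0 ≤ t →
    contractionCoeff (G s) t ≤ c * (F.N s : ℝ) ^ δ * Real.exp (-γ * t)

end Multipartite

end QLMixing

end

/-! Each factor e^{t(E_k - 1)} describes a map applied at the ticks of a Poisson clock: the clock
has not rung by time t with probability q = e^{-t}, and once it has rung, E_k has acted at least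
once. Algebraically, e^{t(E_k - 1)} = q·1 + G_k with G_k = q(e^{tE_k} - 1) completely positive and
of the form E_k (q H_k), where H_k commutes with everything that commutes with E_k
(`exists_semigroup_eq_one_add_mul`).

Because the E_k commute, e^{tL} is the product of these factors. Expanding it, the term ∏ G_k equals
(∏ E_k)(∏ q H_k). Since ∏ E_k prepares ρ and each q H_k multiplies traces by 1 - q, this term is (1
- q)^K times the preparation of ρ. All other terms form a completely positive R
(`exists_semigroup_decomposition`) that scales traces by p = 1 - (1 - q)^K ≤ Kq. Hence e^{tL}σ - ρ =
Rσ - pρ has trace norm at most 2p, which gives the contraction bound K e^{-t} with K ≤ bN.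

This has rate 1, enough for ν ≤ 1. If ν > 1, the gap condition forbids the eigenvalue 0, so the E_k
are injective and only one density operator exists. The smallness of R also excludes traceless
peripheral eigenvectors, which identifies the spectral projection. -/

noncomputable section

namespace QLMixing

/-! ### Completely positive maps -/

section CompletelyPositive

variable {n : Type}

/-- Completely positive maps. -/
def IsCP [Fintype n] (Φ : SuperOp n) : Prop :=
  ∀ (k : ℕ) (X : Matrix (Fin k × n) (Fin k × n) ℂ),
    X.PosSemidef → (ampliation k Φ X).PosSemidef

theorem ampliation_add (k : ℕ) (Φ Ψ : SuperOp n) (X) :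
    ampliation k (Φ + Ψ) X = ampliation k Φ X + ampliation k Ψ X := rfl

theorem ampliation_smul (k : ℕ) (c : ℂ) (Φ : SuperOp n) (X) :
    ampliation k (c • Φ) X = c • ampliation k Φ X := rfl

theorem ampliation_mul (k : ℕ) (Φ Ψ : SuperOp n) (X) :
    ampliation k (Φ * Ψ) X = ampliation k Φ (ampliation k Ψ X) := rfl

variable [Fintype n]

theorem IsCP.zero : IsCP (0 : SuperOp n) := fun _ _ _ => Matrix.PosSemidef.zero

theorem IsCP.one : IsCP (1 : SuperOp n) := fun _ _ hX => hX

theorem IsCP.add {Φ Ψ : SuperOp n} (hΦ : IsCP Φ) (hΨ : IsCP Ψ) : IsCP (Φ + Ψ) :=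
  fun k X hX => by rw [ampliation_add]; exact (hΦ k X hX).add (hΨ k X hX)

theorem IsCP.smul {Φ : SuperOp n} (hΦ : IsCP Φ) {c : ℂ} (hc : 0 ≤ c) : IsCP (c • Φ) :=
  fun k X hX => by rw [ampliation_smul]; exact (hΦ k X hX).smul hc

theorem IsCP.mul {Φ Ψ : SuperOp n} (hΦ : IsCP Φ) (hΨ : IsCP Ψ) : IsCP (Φ * Ψ) :=
  fun k X hX => by rw [ampliation_mul]; exact hΦ k _ (hΨ k X hX)

theorem IsCP.pow {Φ : SuperOp n} (hΦ : IsCP Φ) (m : ℕ) : IsCP (Φ ^ m) := by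
  induction m with
  | zero => simpa using IsCP.one
  | succ m ih => rw [pow_succ]; exact ih.mul hΦ

theorem IsCP.sum {ι : Type*} {s : Finset ι} {Φ : ι → SuperOp n} (h : ∀ i ∈ s, IsCP (Φ i)) :
    IsCP (∑ i ∈ s, Φ i) :=
  Finset.sum_induction _ _ (fun _ _ => IsCP.add) IsCP.zero h

theorem IsCP.list_prod {l : List (SuperOp n)} (h : ∀ Φ ∈ l, IsCP Φ) : IsCP l.prod := by
  induction l with
  | nil => simpa using IsCP.one
  | cons a l ih =>
    rw [List.prod_cons]
    exact (h a (by simp)).mul (ih fun Φ hΦ => h Φ (by simp [hΦ]))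

theorem IsCP.posSemidef {Φ : SuperOp n} (hΦ : IsCP Φ) {X : Matrix n n ℂ} (hX : X.PosSemidef) :
    (Φ X).PosSemidef :=
  (hΦ 1 (X.submatrix Prod.snd Prod.snd) (hX.submatrix _)).submatrix fun x => (0, x)

/-- The map with Kraus operators `L j`. -/
def krausMap {ι : Type*} [Fintype ι] (L : ι → Matrix n n ℂ) : SuperOp n :=
  ∑ j, LinearMap.mulLeft ℂ (L j) ∘ₗ LinearMap.mulRight ℂ (L j).conjTranspose

theorem krausMap_apply {ι : Type*} [Fintype ι] (L : ι → Matrix n n ℂ) (X : Matrix n n ℂ) :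
    krausMap L X = ∑ j, L j * X * (L j).conjTranspose := by
  simp [krausMap, LinearMap.sum_apply, Matrix.mul_assoc]

open scoped Kronecker in
-- Amplifying X ↦ L X L† gives conjugation by 1 ⊗ L, which preserves positivity.
theorem isCP_krausMap {ι : Type*} [Fintype ι] (L : ι → Matrix n n ℂ) : IsCP (krausMap L) := by
  refine IsCP.sum fun j _ k X hX => ?_
  have h : ampliation k (LinearMap.mulLeft ℂ (L j) ∘ₗ LinearMap.mulRight ℂ (L j).conjTranspose) X =
      ((1 : Matrix (Fin k) (Fin k) ℂ) ⊗ₖ L j) * X *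
        ((1 : Matrix (Fin k) (Fin k) ℂ) ⊗ₖ L j).conjTranspose := by
    ext ⟨p, x⟩ ⟨q, y⟩
    simp [ampliation, Matrix.mul_apply, Fintype.sum_prod_type, Matrix.one_apply,
      Finset.mul_sum, Finset.sum_mul, mul_assoc, apply_ite]
    exact Finset.sum_comm
  rw [h]
  exact hX.mul_mul_conjTranspose_same _

theorem exists_eq_conjTranspose_mul_self [DecidableEq n] {P : Matrix n n ℂ} (hP : P.PosSemidef) :
    ∃ B : Matrix n n ℂ, P = B.conjTranspose * B := by
  open scoped MatrixOrder in
  exact CStarAlgebra.nonneg_iff_eq_star_mul_self.mp hP.nonneg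

/-- Choi's theorem. -/
theorem IsCP.exists_krausMap {Φ : SuperOp n} (hΦ : IsCP Φ) :
    ∃ (m : ℕ) (L : Fin m → Matrix n n ℂ), Φ = krausMap L := by
  classical
  let e := Fintype.equivFin n
  -- The unnormalized maximally entangled vector; amplifying Φ on its projector gives the Choi
  -- matrix.
  let v : Fin (Fintype.card n) × n → ℂ := fun p => if e.symm p.1 = p.2 then 1 else 0
  obtain ⟨B, hB⟩ := exists_eq_conjTranspose_mul_self
    (hΦ _ _ (Matrix.posSemidef_vecMulVec_self_star v))
  let f := Fintype.equivFin (Fin (Fintype.card n) × n)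
  -- Each row of a factor B of the Choi matrix B†B, reshaped and conjugated, is a Kraus operator.
  refine ⟨_, fun r => Matrix.of fun x a => star (B (f.symm r) (e a, x)), LinearMap.ext fun X => ?_⟩
  have h (a b x y : n) : Φ (Matrix.single a b 1) x y =
      ∑ r, star (B r (e a, x)) * B r (e b, y) := by
    have := congrFun (congrFun hB (e a, x)) (e b, y)
    rw [Matrix.mul_apply] at this
    simp only [Matrix.conjTranspose_apply] at this
    rw [← this]
    simp only [ampliation, Matrix.of_apply]
    refine congrArg (fun M => Φ M x y) (Matrix.ext fun i j => ?_)
    simp [Matrix.vecMulVec_apply, v, Matrix.single_apply, ite_and]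
    split_ifs <;> rfl
  ext x y
  rw [krausMap_apply, Matrix.sum_apply]
  conv_lhs => rw [Matrix.matrix_eq_sum_single X]
  simp only [map_sum, Matrix.sum_apply, Matrix.mul_apply, Matrix.conjTranspose_apply,
    Matrix.of_apply, star_star]
  have h2 (a b : n) : Φ (Matrix.single a b (X a b)) x y =
      X a b * ∑ r, star (B r (e a, x)) * B r (e b, y) := by
    rw [← h, ← smul_eq_mul, ← Matrix.smul_apply, ← map_smul, Matrix.smul_single, smul_eq_mul,
      mul_one]
  simp only [h2]
  rw [Equiv.sum_comp f.symm (fun r => ∑ b, (∑ a, star (B r (e a, x)) * X a b) * B r (e b, y))]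
  simp only [Finset.mul_sum, Finset.sum_mul]
  rw [Finset.sum_comm]
  conv_rhs => rw [Finset.sum_comm]
  refine Finset.sum_congr rfl fun b _ => ?_
  rw [Finset.sum_comm]
  exact Finset.sum_congr rfl fun r _ => Finset.sum_congr rfl fun a _ => by ring

/-- By cyclicity, trace preservation says that ∑ L†L and 1 have the same trace pairing with every X,
and this pairing is nondegenerate. -/
theorem sum_conjTranspose_mul_self_eq_one {ι : Type*} [Fintype ι] [DecidableEq n]
    {L : ι → Matrix n n ℂ} (h : ∀ X, (krausMap L X).trace = X.trace) :
    ∑ j, (L j).conjTranspose * L j = 1 := by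
  rw [Matrix.ext_iff_trace_mul_right]
  intro X
  rw [one_mul, ← h X, krausMap_apply, Finset.sum_mul, Matrix.trace_sum, Matrix.trace_sum]
  exact Finset.sum_congr rfl fun j _ => by
    rw [Matrix.mul_assoc, Matrix.trace_mul_comm]

/-- `Φ - 1` is a Liouvillian for each channel `Φ`. -/
theorem IsCPTP.isLiouvillian_sub_one {Φ : SuperOp n} (hΦ : IsCPTP Φ) : IsLiouvillian (Φ - 1) := by
  classical
  obtain ⟨m, L, rfl⟩ := IsCP.exists_krausMap hΦ.1
  -- Take no Hamiltonian and the Kraus operators as jump operators: ∑ L†L = 1 turns the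
  -- anticommutator term into -X.
  refine ⟨0, m, L, Matrix.isHermitian_zero, fun X => ?_⟩
  have h := sum_conjTranspose_mul_self_eq_one hΦ.2
  rw [Finset.sum_sub_distrib, ← Finset.smul_sum, Finset.sum_add_distrib, ← Finset.sum_mul,
    ← Finset.mul_sum, h, LinearMap.sub_apply, krausMap_apply]
  simp [← two_smul ℂ X, smul_smul]

end CompletelyPositive

/-! ### Extending local maps by the identity -/

section Extend

variable {N d : ℕ}

theorem glue_restrict (S : Finset (Fin N)) (x : Config N d) :
    glue S (fun i => x i) x = x := by
  ext i
  simp [glue]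

theorem extend_sub_one (S : Finset (Fin N)) (Φ : SuperOp (LocalConfig d S)) :
    extend S (Φ - 1) = extend S Φ - 1 := by
  ext X x y
  simp [extend, glue_restrict]

/-- The operator `L ⊗ 1`. -/
def extendOp (S : Finset (Fin N)) (L : Matrix (LocalConfig d S) (LocalConfig d S) ℂ) :
    Matrix (Config N d) (Config N d) ℂ :=
  Matrix.of fun x z => ∑ a, if glue S a x = z then L (fun i => x i) a else 0

/-- Reduces complete positivity of Φ ⊗ id to the Kraus form. -/
theorem extend_krausMap {ι : Type*} [Fintype ι] (S : Finset (Fin N))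
    (L : ι → Matrix (LocalConfig d S) (LocalConfig d S) ℂ) :
    extend S (krausMap L) = krausMap fun j => extendOp S (L j) := by
  refine LinearMap.ext fun X => ?_
  ext x y
  simp only [extend, krausMap_apply, LinearMap.coe_mk, AddHom.coe_mk, Matrix.of_apply,
    Matrix.sum_apply]
  refine Finset.sum_congr rfl fun j _ => ?_
  simp only [Matrix.mul_apply, Matrix.conjTranspose_apply, extendOp, Matrix.of_apply, star_sum,
    Finset.sum_mul, Finset.mul_sum, apply_ite (star : ℂ → ℂ), star_zero, ite_mul, mul_ite,
    zero_mul, mul_zero]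
  rw [Finset.sum_comm (s := Finset.univ (α := Config N d))]
  refine Finset.sum_congr rfl fun b _ => ?_
  rw [Finset.sum_ite_eq, if_pos (Finset.mem_univ _), Finset.sum_comm]
  exact Finset.sum_congr rfl fun a _ => by rw [Finset.sum_ite_eq, if_pos (Finset.mem_univ _)]

theorem IsCP.extend {S : Finset (Fin N)} {Φ : SuperOp (LocalConfig d S)} (hΦ : IsCP Φ) :
    IsCP (extend S Φ) := by
  obtain ⟨m, L, rfl⟩ := hΦ.exists_krausMap
  rw [extend_krausMap]
  exact isCP_krausMap _

/-- For a fixed configuration c outside S, the sum over the inside configurations is the trace of Φ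
applied to the diagonal block at c. -/
theorem trace_extend {S : Finset (Fin N)} {Φ : SuperOp (LocalConfig d S)}
    (hΦ : ∀ X, (Φ X).trace = X.trace) (X : Matrix (Config N d) (Config N d) ℂ) :
    (extend S Φ X).trace = X.trace := by
  let e := Equiv.piEquivPiSubtypeProd (fun i : Fin N => i ∈ S) fun _ => Fin d
  have hg (a a' : LocalConfig d S) (c) : glue S a (e.symm (a', c)) = e.symm (a, c) := by
    ext i
    by_cases h : i ∈ S <;> simp [glue, e, Equiv.piEquivPiSubtypeProd, h]
  have hr (a : LocalConfig d S) (c) : (fun i : {i // i ∈ S} => e.symm (a, c) i) = a := by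
    ext i
    simp [e, Equiv.piEquivPiSubtypeProd]
  simp only [Matrix.trace, Matrix.diag_apply]
  rw [← Equiv.sum_comp e.symm, ← Equiv.sum_comp e.symm, Fintype.sum_prod_type_right,
    Fintype.sum_prod_type_right]
  refine Finset.sum_congr rfl fun c _ => ?_
  simp only [extend, LinearMap.coe_mk, AddHom.coe_mk, Matrix.of_apply, hg]
  have h := hΦ (Matrix.of fun a b => X (e.symm (a, c)) (e.symm (b, c)))
  simp only [Matrix.trace, Matrix.diag_apply, Matrix.of_apply] at h
  rw [← h]
  exact Finset.sum_congr rfl fun a _ => by rw [hr]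

theorem IsNeighborhoodMap.isNeighborhoodLiouvillian {S : Finset (Fin N)}
    {E : SuperOp (Config N d)} (h : IsNeighborhoodMap S E) :
    IsNeighborhoodLiouvillian S (E - 1) := by
  obtain ⟨Φ, hΦ, rfl⟩ := h
  exact ⟨Φ - 1, hΦ.isLiouvillian_sub_one, (extend_sub_one S Φ).symm⟩

theorem IsNeighborhoodMap.isCPTP {S : Finset (Fin N)}
    {E : SuperOp (Config N d)} (h : IsNeighborhoodMap S E) : IsCPTP E := by
  obtain ⟨Φ, hΦ, rfl⟩ := h
  exact ⟨IsCP.extend hΦ.1, trace_extend hΦ.2⟩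

end Extend

/-! ### The trace norm -/

section TraceNorm

variable {n : Type} [Fintype n]

theorem trace_conjTranspose_mul (X Y : Matrix n n ℂ) :
    (X.conjTranspose * Y).trace = ∑ i, ∑ j, star (X j i) * Y j i := by
  simp [Matrix.trace, Matrix.mul_apply]

theorem trace_conjTranspose_mul_self (X : Matrix n n ℂ) :
    (X.conjTranspose * X).trace.re = ∑ i, ∑ j, ‖X j i‖ ^ 2 := by
  simp only [trace_conjTranspose_mul, Complex.re_sum]
  refine Finset.sum_congr rfl fun i _ => Finset.sum_congr rfl fun j _ => ?_
  rw [Complex.star_def, ← Complex.normSq_eq_conj_mul_self, Complex.ofReal_re,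
    Complex.normSq_eq_norm_sq]

theorem norm_trace_conjTranspose_mul_le (X Y : Matrix n n ℂ) :
    ‖(X.conjTranspose * Y).trace‖ ≤
      ((X.conjTranspose * X).trace.re + (Y.conjTranspose * Y).trace.re) / 2 := by
  rw [trace_conjTranspose_mul_self, trace_conjTranspose_mul_self, trace_conjTranspose_mul,
    ← Finset.sum_add_distrib, Finset.sum_div]
  refine (norm_sum_le _ _).trans (Finset.sum_le_sum fun i _ => ?_)
  rw [← Finset.sum_add_distrib, Finset.sum_div]
  refine (norm_sum_le _ _).trans (Finset.sum_le_sum fun j _ => ?_)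
  rw [norm_mul, norm_star]
  nlinarith [sq_nonneg (‖X j i‖ - ‖Y j i‖)]

theorem mul_conjTranspose_polarization (Y Z : Matrix n n ℂ) :
    Y * Z.conjTranspose = ∑ k : Fin 4, Complex.I ^ (k : ℕ) • (1 / 4 : ℂ) •
      ((Y + Complex.I ^ (k : ℕ) • Z) * (Y + Complex.I ^ (k : ℕ) • Z).conjTranspose) := by
  simp only [Fin.sum_univ_four, Matrix.conjTranspose_add, Matrix.conjTranspose_smul,
    Matrix.mul_add, Matrix.add_mul, Matrix.smul_mul, Matrix.mul_smul]
  ext i j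
  simp [Complex.I_pow_three]
  ring_nf
  simp
  ring

theorem trace_polarization (Y Z : Matrix n n ℂ) :
    ∑ k : Fin 4, ((1 / 4 : ℂ) • ((Y + Complex.I ^ (k : ℕ) • Z) *
      (Y + Complex.I ^ (k : ℕ) • Z).conjTranspose)).trace.re =
      (Y * Y.conjTranspose).trace.re + (Z * Z.conjTranspose).trace.re := by
  simp only [Fin.sum_univ_four, Matrix.conjTranspose_add, Matrix.conjTranspose_smul,
    Matrix.mul_add, Matrix.add_mul, Matrix.smul_mul, Matrix.mul_smul, Matrix.trace_smul,
    Matrix.trace_add]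
  simp [Complex.I_pow_three]
  ring

variable [DecidableEq n]

theorem traceNorm_nonneg (X : Matrix n n ℂ) : 0 ≤ traceNorm X :=
  Finset.sum_nonneg fun _ _ => Real.sqrt_nonneg _

/-- The singular value decomposition, with a partial isometry `U` and a unitary `V`. -/
theorem exists_singularValueDecomposition (A : Matrix n n ℂ) :
    ∃ (U V : Matrix n n ℂ) (s : n → ℝ), (∀ i, 0 ≤ s i) ∧ ∑ i, s i = traceNorm A ∧
      V.conjTranspose * V = 1 ∧ V * V.conjTranspose = 1 ∧
      U.conjTranspose * U * Matrix.diagonal (fun i => (s i : ℂ)) =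
        Matrix.diagonal (fun i => (s i : ℂ)) ∧
      (1 - U * U.conjTranspose).PosSemidef ∧
      A = U * Matrix.diagonal (fun i => (s i : ℂ)) * V.conjTranspose := by
  let hA := Matrix.isHermitian_conjTranspose_mul_self A
  let s : n → ℝ := fun i => √(hA.eigenvalues i)
  have hs (i) : (s i : ℂ) * s i = hA.eigenvalues i := by
    rw [← Complex.ofReal_mul,
      Real.mul_self_sqrt (Matrix.eigenvalues_conjTranspose_mul_self_nonneg A i)]
  let V : Matrix n n ℂ := hA.eigenvectorUnitary
  have hV1 : V.conjTranspose * V = 1 := Unitary.coe_star_mul_self hA.eigenvectorUnitary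
  have hV2 : V * V.conjTranspose = 1 := Unitary.coe_mul_star_self hA.eigenvectorUnitary
  have hD : V.conjTranspose * (A.conjTranspose * A) * V =
      Matrix.diagonal (fun i => (s i : ℂ) * s i) := by
    have h := hA.conjStarAlgAut_star_eigenvectorUnitary
    rw [Unitary.conjStarAlgAut_star_apply] at h
    simp only [hs]
    exact h
  -- Since 0⁻¹ = 0, this is the pseudo-inverse of the singular values, and U = A V T is only a
  -- partial isometry.
  let T : Matrix n n ℂ := Matrix.diagonal fun i => ((s i)⁻¹ : ℂ)
  have hT : T.conjTranspose = T := by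
    simp only [T, Matrix.diagonal_conjTranspose]
    congr 1
    ext i
    simp
  have hU : (A * V * T).conjTranspose * (A * V * T) =
      Matrix.diagonal fun i => (s i : ℂ) * (s i : ℂ)⁻¹ := by
    calc _ = T * (V.conjTranspose * (A.conjTranspose * A) * V) * T := by
          simp only [Matrix.conjTranspose_mul, hT, Matrix.mul_assoc]
      _ = _ := by
          rw [hD]
          simp only [T, Matrix.diagonal_mul_diagonal]
          congr 1
          ext i
          by_cases h : (s i : ℂ) = 0
          · simp [h]
          · field_simp
  have hZ : A * V = A * V * T * Matrix.diagonal (fun i => (s i : ℂ)) := by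
    have h : A * V - A * V * T * Matrix.diagonal (fun i => (s i : ℂ)) =
        A * V * Matrix.diagonal fun i => 1 - (s i : ℂ)⁻¹ * s i := by
      have h1 : (Matrix.diagonal fun i => 1 - (s i : ℂ)⁻¹ * s i) =
          1 - T * Matrix.diagonal (fun i => (s i : ℂ)) := by
        rw [Matrix.diagonal_mul_diagonal, ← Matrix.diagonal_one, Matrix.diagonal_sub]
      rw [h1, Matrix.mul_sub, Matrix.mul_one, Matrix.mul_assoc (A * V)]
    -- A V vanishes on the directions of singular value zero: M = 0 follows from M†M = 0.
    rw [← sub_eq_zero, h, ← Matrix.conjTranspose_mul_self_eq_zero]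
    calc _ = (Matrix.diagonal fun i => 1 - (s i : ℂ)⁻¹ * s i).conjTranspose *
          (V.conjTranspose * (A.conjTranspose * A) * V) *
          (Matrix.diagonal fun i => 1 - (s i : ℂ)⁻¹ * s i) := by
          simp only [Matrix.conjTranspose_mul, Matrix.mul_assoc]
      _ = 0 := by
          rw [hD, Matrix.diagonal_conjTranspose, Matrix.diagonal_mul_diagonal,
            Matrix.diagonal_mul_diagonal, ← Matrix.diagonal_zero]
          congr 1
          ext i
          by_cases h : (s i : ℂ) = 0 <;> simp [h]
  refine ⟨A * V * T, V, s, fun i => Real.sqrt_nonneg _, rfl, hV1, hV2, ?_, ?_, ?_⟩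
  · rw [hU, Matrix.diagonal_mul_diagonal]
    congr 1
    ext i
    by_cases h : (s i : ℂ) = 0 <;> simp [h]
  · set U := A * V * T
    have h1 : U * (U.conjTranspose * U) = U := by
      rw [hU]
      simp only [U, T, Matrix.mul_assoc, Matrix.diagonal_mul_diagonal]
      congr 3
      ext i
      by_cases h : (s i : ℂ) = 0 <;> simp [h]
    clear_value U
    -- U U† is an orthogonal projection, hence so is its complement.
    have h2 : 1 - U * U.conjTranspose =
        (1 - U * U.conjTranspose).conjTranspose * (1 - U * U.conjTranspose) := by
      have h3 : U * U.conjTranspose * (U * U.conjTranspose) = U * U.conjTranspose := by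
        rw [← Matrix.mul_assoc, Matrix.mul_assoc U, h1]
      rw [Matrix.conjTranspose_sub, Matrix.conjTranspose_mul, Matrix.conjTranspose_one,
        Matrix.conjTranspose_conjTranspose, Matrix.sub_mul, Matrix.mul_sub, Matrix.mul_sub, h3]
      simp
    rw [h2]
    exact Matrix.posSemidef_conjTranspose_mul_self _
  · rw [← hZ, Matrix.mul_assoc, hV2, Matrix.mul_one]

/-- With P = B†B the trace is the Hilbert–Schmidt pairing of BU and BV, whose squared norms are at
most tr P. -/
theorem norm_trace_mul_le {U V P : Matrix n n ℂ} (hP : P.PosSemidef)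
    (hV : V * V.conjTranspose = 1) (hU : (1 - U * U.conjTranspose).PosSemidef) :
    ‖(V * U.conjTranspose * P).trace‖ ≤ P.trace.re := by
  obtain ⟨B, rfl⟩ := exists_eq_conjTranspose_mul_self hP
  have h := norm_trace_conjTranspose_mul_le (B * U) (B * V)
  have h1 : ((B * V).conjTranspose * (B * V)).trace = (B.conjTranspose * B).trace := by
    rw [Matrix.trace_mul_comm, Matrix.conjTranspose_mul, Matrix.mul_assoc, ← Matrix.mul_assoc V,
      hV, Matrix.one_mul, Matrix.trace_mul_comm]
  have h2 : ((B * U).conjTranspose * (B * U)).trace.re ≤ (B.conjTranspose * B).trace.re := by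
    have h3 := (Complex.le_def.1 (hU.mul_mul_conjTranspose_same B).trace_nonneg).1
    rw [Matrix.mul_sub, Matrix.sub_mul, Matrix.mul_one, Matrix.trace_sub, Complex.sub_re,
      Complex.zero_re, sub_nonneg, Matrix.trace_mul_comm B] at h3
    rwa [Matrix.trace_mul_comm, Matrix.conjTranspose_mul, Matrix.mul_assoc B, ← Matrix.mul_assoc U,
      ← Matrix.mul_assoc B]
  have h4 : (V * U.conjTranspose * (B.conjTranspose * B)).trace =
      ((B * U).conjTranspose * (B * V)).trace := by
    rw [Matrix.mul_assoc, Matrix.trace_mul_comm, Matrix.conjTranspose_mul]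
    simp only [Matrix.mul_assoc]
  rw [h4]
  rw [h1] at h
  linarith

/-- The trace norm of the sum A is the value at A of the linear functional tr(V U† ·) from its
singular value decomposition; each term is then bounded by `norm_trace_mul_le`. This plays the role
of the triangle inequality. -/
theorem traceNorm_sum_smul_le {ι : Type*} (t : Finset ι) (c : ι → ℂ) {P : ι → Matrix n n ℂ}
    (hP : ∀ i ∈ t, (P i).PosSemidef) :
    traceNorm (∑ i ∈ t, c i • P i) ≤ ∑ i ∈ t, ‖c i‖ * (P i).trace.re := by
  obtain ⟨U, V, s, hs, hsum, hV1, hV2, hUs, hU, hA⟩ :=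
    exists_singularValueDecomposition (∑ i ∈ t, c i • P i)
  have h : ((traceNorm (∑ i ∈ t, c i • P i) : ℝ) : ℂ) =
      (V * U.conjTranspose * ∑ i ∈ t, c i • P i).trace := by
    conv_rhs => rw [hA]
    rw [Matrix.mul_assoc V, Matrix.trace_mul_comm, ← Matrix.mul_assoc, ← Matrix.mul_assoc, hUs,
      Matrix.mul_assoc, hV1, Matrix.mul_one, Matrix.trace_diagonal, ← hsum, Complex.ofReal_sum]
  have h0 := traceNorm_nonneg (∑ i ∈ t, c i • P i)
  have h1 : traceNorm (∑ i ∈ t, c i • P i) =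
      ‖((traceNorm (∑ i ∈ t, c i • P i) : ℝ) : ℂ)‖ := by
    rw [Complex.norm_real, Real.norm_of_nonneg h0]
  rw [h1, h, Finset.mul_sum, Matrix.trace_sum]
  refine (norm_sum_le _ _).trans (Finset.sum_le_sum fun i hi => ?_)
  rw [Matrix.mul_smul, Matrix.trace_smul, norm_smul]
  exact mul_le_mul_of_nonneg_left (norm_trace_mul_le (hP i hi) hV2 hU) (norm_nonneg _)

theorem traceNorm_sub_le {P Q : Matrix n n ℂ} (hP : P.PosSemidef) (hQ : Q.PosSemidef) :
    traceNorm (P - Q) ≤ P.trace.re + Q.trace.re := by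
  have h := traceNorm_sum_smul_le Finset.univ ![1, -1] (P := ![P, Q])
    (by simp [Fin.forall_fin_two, hP, hQ])
  simpa [Fin.sum_univ_two, ← sub_eq_add_neg] using h

theorem traceNorm_zero : traceNorm (0 : Matrix n n ℂ) = 0 := by
  refine le_antisymm ?_ (traceNorm_nonneg _)
  simpa using traceNorm_sub_le (n := n) .zero .zero

/-- Every operator is a combination of four positive semidefinite ones. -/
theorem exists_posSemidef_decomposition (X : Matrix n n ℂ) :
    ∃ P : Fin 4 → Matrix n n ℂ, (∀ k, (P k).PosSemidef) ∧
      X = ∑ k : Fin 4, Complex.I ^ (k : ℕ) • P k ∧ ∑ k, (P k).trace.re = 2 * traceNorm X := by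
  obtain ⟨U, V, s, hs, hsum, hV1, hV2, hUs, hU, hX⟩ := exists_singularValueDecomposition X
  -- Splitting the singular values as R R† writes X as (UR)(VR)†, ready for polarization; UR and VR
  -- each contribute ‖X‖₁ to the total trace.
  let R : Matrix n n ℂ := Matrix.diagonal fun i => ((√(s i) : ℝ) : ℂ)
  have hR : R * R.conjTranspose = Matrix.diagonal fun i => (s i : ℂ) := by
    rw [Matrix.diagonal_conjTranspose, Matrix.diagonal_mul_diagonal]
    congr 1
    ext i
    simp [← Complex.ofReal_mul, Real.mul_self_sqrt (hs i)]
  have htr (W : Matrix n n ℂ) : (W * R * (W * R).conjTranspose).trace =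
      (W.conjTranspose * W * Matrix.diagonal fun i => (s i : ℂ)).trace := by
    rw [Matrix.conjTranspose_mul, Matrix.mul_assoc, ← Matrix.mul_assoc R, hR,
      ← Matrix.mul_assoc, Matrix.trace_mul_comm, Matrix.mul_assoc]
  have hs2 : (Matrix.diagonal fun i => (s i : ℂ)).trace.re = traceNorm X := by
    rw [Matrix.trace_diagonal, ← hsum, ← Complex.ofReal_sum, Complex.ofReal_re]
  have hXR : X = U * R * (V * R).conjTranspose := by
    rw [Matrix.conjTranspose_mul, Matrix.mul_assoc, ← Matrix.mul_assoc R, hR,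
      ← Matrix.mul_assoc, hX]
  refine ⟨fun k => (1 / 4 : ℂ) • ((U * R + Complex.I ^ (k : ℕ) • (V * R)) *
      (U * R + Complex.I ^ (k : ℕ) • (V * R)).conjTranspose),
    fun k => (Matrix.posSemidef_self_mul_conjTranspose _).smul (by positivity), ?_, ?_⟩
  · rw [← mul_conjTranspose_polarization]
    exact hXR
  · rw [trace_polarization, htr, htr, hUs, hV1, Matrix.one_mul, hs2, two_mul]

theorem eq_zero_of_traceNorm_eq_zero {X : Matrix n n ℂ} (h : traceNorm X = 0) : X = 0 := by
  obtain ⟨P, hP, hX, htr⟩ := exists_posSemidef_decomposition X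
  rw [h, mul_zero, Finset.sum_eq_zero_iff_of_nonneg
    fun k _ => (Complex.le_def.1 (hP k).trace_nonneg).1] at htr
  rw [hX]
  refine Finset.sum_eq_zero fun k hk => ?_
  have h1 : (P k).trace = 0 := Complex.ext (htr k hk)
    (Complex.le_def.1 (hP k).trace_nonneg).2.symm
  rw [(hP k).trace_eq_zero_iff.1 h1, smul_zero]

theorem IsCPTP.traceNorm_sub_le {Φ : SuperOp n} (hΦ : IsCPTP Φ) (X : Matrix n n ℂ) :
    traceNorm ((Φ - 1) X) ≤ 4 * traceNorm X := by
  obtain ⟨P, hP, hX, htr⟩ := exists_posSemidef_decomposition X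
  -- The pieces P k and their images under Φ each have total trace 2‖X‖₁, whence the constant 4.
  have h := traceNorm_sum_smul_le (Finset.univ : Finset (Fin 4 × Bool))
    (fun p => if p.2 then Complex.I ^ (p.1 : ℕ) else -Complex.I ^ (p.1 : ℕ))
    (P := fun p => if p.2 then Φ (P p.1) else P p.1) (by
      rintro ⟨k, b⟩ -
      cases b
      · simpa using hP k
      · simpa using IsCP.posSemidef hΦ.1 (hP k))
  have h1 : (Φ - 1) X = ∑ p : Fin 4 × Bool,
      (if p.2 then Complex.I ^ (p.1 : ℕ) else -Complex.I ^ (p.1 : ℕ)) •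
        (if p.2 then Φ (P p.1) else P p.1) := by
    conv_lhs => rw [hX]
    simp [Fintype.sum_prod_type, Finset.sum_add_distrib, sub_eq_add_neg, map_sum]
  rw [h1]
  refine h.trans (le_of_eq ?_)
  simp [Fintype.sum_prod_type, Finset.sum_add_distrib, hΦ.2, htr]
  ring

end TraceNorm

/-! ### Semigroups -/

section Semigroup

/-- Take h = ∑ xⁿ/(n+1)!, the quotient (eˣ - 1)/x, which makes sense for noninvertible x and
commutes with the commutant of x. -/
theorem exists_exp_eq_one_add_mul {m : Type*} [Fintype m] [DecidableEq m] (x : Matrix m m ℂ) :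
    HasSum (fun k : ℕ => ((k.factorial : ℂ)⁻¹) • x ^ k) (NormedSpace.exp x) ∧
      ∃ h, NormedSpace.exp x = 1 + x * h ∧ ∀ y, Commute x y → Commute h y := by
  let : NormedRing (Matrix m m ℂ) := Matrix.linftyOpNormedRing
  let : NormedAlgebra ℂ (Matrix m m ℂ) := Matrix.linftyOpNormedAlgebra
  have hexp : HasSum (fun k : ℕ => ((k.factorial : ℂ)⁻¹) • x ^ k) (NormedSpace.exp x) :=
    NormedSpace.exp_series_hasSum_exp' x
  have hb : Summable fun n : ℕ => ((n + 1).factorial⁻¹ : ℂ) • x ^ n := by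
    refine .of_norm_bounded_eventually (Real.summable_pow_div_factorial ‖x‖) ?_
    filter_upwards [Filter.eventually_cofinite_ne 0] with n hn
    rw [norm_smul, mul_comm, norm_inv, RCLike.norm_natCast, ← div_eq_mul_inv]
    gcongr
    · exact norm_pow_le' _ (pos_iff_ne_zero.mpr hn)
    · exact n.le_succ
  refine ⟨hexp, ∑' n : ℕ, ((n + 1).factorial⁻¹ : ℂ) • x ^ n, ?_, fun y hy => ?_⟩
  · rw [← hexp.tsum_eq, hexp.summable.tsum_eq_zero_add, ← hb.tsum_mul_left]
    simp [pow_succ']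
  · exact (Commute.tsum_right y fun n => ((hy.pow_left n).smul_left _).symm).symm

variable {n : Type} [Fintype n] [DecidableEq n]

/-- The matrix of a superoperator in the standard basis of the operator space. -/
abbrev superMatrix : SuperOp n ≃ₐ[ℂ] Matrix (n × n) (n × n) ℂ :=
  LinearMap.toMatrixAlgEquiv (Matrix.stdBasis ℂ n n)

theorem superMatrix_semigroup (Φ : SuperOp n) (t : ℝ) :
    superMatrix (semigroup Φ t) = NormedSpace.exp ((t : ℂ) • superMatrix Φ) :=
  AlgEquiv.apply_symm_apply _ _

theorem hasSum_superMatrix_semigroup (Φ : SuperOp n) (t : ℝ) :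
    HasSum (fun k : ℕ => superMatrix (((t : ℂ) ^ k / (k.factorial : ℂ)) • Φ ^ k))
      (superMatrix (semigroup Φ t)) := by
  rw [superMatrix_semigroup]
  convert (exists_exp_eq_one_add_mul ((t : ℂ) • superMatrix Φ)).1 using 2 with k
  rw [smul_pow, smul_smul, map_smul, map_pow, div_eq_inv_mul]

theorem exists_semigroup_eq_one_add_mul (Φ : SuperOp n) (t : ℝ) :
    ∃ H, semigroup Φ t = 1 + Φ * H ∧ ∀ Ψ, Commute Φ Ψ → Commute H Ψ := by
  obtain ⟨-, h, h1, h2⟩ := exists_exp_eq_one_add_mul ((t : ℂ) • superMatrix Φ)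
  refine ⟨superMatrix.symm ((t : ℂ) • h), superMatrix.injective ?_, fun Ψ hΨ => ?_⟩
  · rw [superMatrix_semigroup, h1]
    simp
  · have := ((h2 _ ((hΨ.map superMatrix).smul_left (t : ℂ))).smul_left (t : ℂ)).map
      superMatrix.symm
    simpa using this

theorem semigroup_add {Φ Ψ : SuperOp n} (h : Commute Φ Ψ) (t : ℝ) :
    semigroup (Φ + Ψ) t = semigroup Φ t * semigroup Ψ t := by
  apply superMatrix.injective
  rw [map_mul, superMatrix_semigroup, superMatrix_semigroup, superMatrix_semigroup, map_add,
    smul_add]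
  exact Matrix.exp_add_of_commute _ _
    (((h.map superMatrix).smul_left (t : ℂ)).smul_right (t : ℂ))

theorem semigroup_zero (t : ℝ) : semigroup (0 : SuperOp n) t = 1 := by
  obtain ⟨H, h, -⟩ := exists_semigroup_eq_one_add_mul (0 : SuperOp n) t
  simpa using h

theorem semigroup_list_sum {l : List (SuperOp n)} (h : ∀ Φ ∈ l, ∀ Ψ ∈ l, Commute Φ Ψ) (t : ℝ) :
    semigroup l.sum t = (l.map fun Φ => semigroup Φ t).prod := by
  induction l with
  | nil => simpa using semigroup_zero t
  | cons Φ l ih =>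
    rw [List.sum_cons, List.map_cons, List.prod_cons,
      semigroup_add (Commute.list_sum_right _ _ fun Ψ hΨ => h Φ (by simp) Ψ (by simp [hΨ])),
      ih fun Φ hΦ Ψ hΨ => h Φ (by simp [hΦ]) Ψ (by simp [hΨ])]

/-- Evaluation of a superoperator given by its matrix. -/
def superEval (X : Matrix n n ℂ) : Matrix (n × n) (n × n) ℂ →ₗ[ℂ] Matrix n n ℂ :=
  LinearMap.applyₗ X ∘ₗ superMatrix.symm.toLinearMap

theorem superEval_superMatrix (X : Matrix n n ℂ) (Φ : SuperOp n) :
    superEval X (superMatrix Φ) = Φ X := by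
  simp [superEval]

theorem hasSum_semigroup_apply (Φ : SuperOp n) (t : ℝ) (X : Matrix n n ℂ) :
    HasSum (fun k : ℕ => ((t : ℂ) ^ k / (k.factorial : ℂ)) • (Φ ^ k) X) (semigroup Φ t X) := by
  have h := (hasSum_superMatrix_semigroup Φ t).map (superEval X)
    (LinearMap.continuous_of_finiteDimensional (superEval X))
  simpa only [superEval_superMatrix, Function.comp_def, LinearMap.smul_apply] using h

theorem semigroup_apply_of_eigenvector {Φ : SuperOp n} {μ : ℂ} {X : Matrix n n ℂ}
    (h : Φ X = μ • X) (t : ℝ) : semigroup Φ t X = Complex.exp (t * μ) • X := by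
  have hk (k : ℕ) : (Φ ^ k) X = μ ^ k • X := by
    induction k with
    | zero => simp
    | succ k ih => rw [pow_succ', Module.End.mul_apply, ih, map_smul, h, smul_smul, pow_succ]
  refine (hasSum_semigroup_apply Φ t X).unique ?_
  simp only [hk, smul_smul]
  refine HasSum.smul_const ?_ X
  have := NormedSpace.expSeries_div_hasSum_exp (𝔸 := ℂ) (t * μ)
  rw [← Complex.exp_eq_exp_ℂ] at this
  convert this using 2 with k
  rw [mul_pow, div_mul_eq_mul_div]

theorem semigroup_sub_one (Φ : SuperOp n) (t : ℝ) :
    semigroup (Φ - 1) t = (Real.exp (-t) : ℂ) • semigroup Φ t := by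
  have h : semigroup (-1 : SuperOp n) t = (Real.exp (-t) : ℂ) • 1 := by
    refine LinearMap.ext fun X => ?_
    rw [semigroup_apply_of_eigenvector (μ := -1) (by simp)]
    simp
  rw [sub_eq_add_neg, semigroup_add (Commute.neg_one_right Φ), h, mul_smul_comm, mul_one]

theorem isClosed_posSemidef {m : Type*} [Fintype m] :
    IsClosed {X : Matrix m m ℂ | X.PosSemidef} := by
  simp only [Matrix.posSemidef_iff_dotProduct_mulVec, Set.ofPred_and, Set.ofPred_forall]
  refine IsClosed.inter ?_ (isClosed_iInter fun x => ?_)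
  · exact isClosed_eq (by fun_prop) continuous_id
  · exact isClosed_le continuous_const
      (by fun_prop)

/-- Without its constant term the exponential series still has completely positive terms, and the
positive semidefinite cone is closed. -/
theorem IsCP.semigroup_sub_one {Φ : SuperOp n} (hΦ : IsCP Φ) {t : ℝ} (ht : 0 ≤ t) :
    IsCP (semigroup Φ t - 1) := by
  intro k X hX
  have h (Y : Matrix n n ℂ) := (hasSum_nat_add_iff' 1).2 (hasSum_semigroup_apply Φ t Y)
  have h1 : HasSum (fun j => ampliation k
      (((t : ℂ) ^ (j + 1) / ((j + 1).factorial : ℂ)) • Φ ^ (j + 1)) X)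
      (ampliation k (semigroup Φ t - 1) X) := by
    refine Pi.hasSum.2 fun p => Pi.hasSum.2 fun q => ?_
    have h2 := Pi.hasSum.1 (Pi.hasSum.1 (h (Matrix.of fun x y => X (p.1, x) (q.1, y))) p.2) q.2
    simpa [ampliation] using h2
  refine isClosed_posSemidef.mem_of_tendsto h1 (Filter.Eventually.of_forall fun s => ?_)
  refine Finset.sum_induction _ Matrix.PosSemidef (fun _ _ => Matrix.PosSemidef.add)
    Matrix.PosSemidef.zero fun j _ => ?_
  have hc : (0 : ℂ) ≤ (t : ℂ) ^ (j + 1) / ((j + 1).factorial : ℂ) := by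
    have : (0 : ℝ) ≤ t ^ (j + 1) / ((j + 1).factorial : ℝ) := by positivity
    exact_mod_cast this
  exact (hΦ.pow _).smul hc k X hX

theorem trace_semigroup_apply {G : SuperOp n} (hG : ∀ X, (G X).trace = 0) (t : ℝ)
    (X : Matrix n n ℂ) : (semigroup G t X).trace = X.trace := by
  obtain ⟨H, h, -⟩ := exists_semigroup_eq_one_add_mul G t
  rw [h]
  simp [hG]

end Semigroup

/-! ### Commuting channels whose composition prepares a state -/

section Preparation

variable {n : Type} [Fintype n]

/-- A superoperator that maps all densities to `ρ` is `X ↦ tr(X) ρ`. -/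
theorem apply_eq_trace_smul {Φ : SuperOp n} {ρ : Matrix n n ℂ}
    (h : ∀ σ, IsDensity σ → Φ σ = ρ) (X : Matrix n n ℂ) : Φ X = X.trace • ρ := by
  classical
  have hP {P : Matrix n n ℂ} (hP : P.PosSemidef) : Φ P = P.trace • ρ := by
    by_cases h0 : P.trace = 0
    · rw [hP.trace_eq_zero_iff.1 h0]
      simp
    · have h1 : IsDensity (P.trace⁻¹ • P) :=
        ⟨hP.smul (inv_nonneg.2 hP.trace_nonneg), by
          rw [Matrix.trace_smul, smul_eq_mul, inv_mul_cancel₀ h0]⟩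
      rw [← h _ h1, map_smul, smul_smul, mul_inv_cancel₀ h0, one_smul]
  obtain ⟨P, hP4, hX, -⟩ := exists_posSemidef_decomposition X
  rw [hX, map_sum, Matrix.trace_sum, Finset.sum_smul]
  refine Finset.sum_congr rfl fun k _ => ?_
  rw [map_smul, hP (hP4 k), Matrix.trace_smul, smul_eq_mul, mul_smul]

/-- Only moving a g past an f is needed; the order within each family is kept. -/
theorem list_prod_map_mul {ι M : Type*} [Monoid M] {f g : ι → M}
    (h : ∀ i j, Commute (g i) (f j)) (l : List ι) :
    (l.map fun i => f i * g i).prod = (l.map f).prod * (l.map g).prod := by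
  induction l with
  | nil => simp
  | cons i l ih =>
    have hc : Commute (g i) (l.map f).prod :=
      Commute.list_prod_right _ _ fun x hx => by
        obtain ⟨j, -, rfl⟩ := List.mem_map.1 hx
        exact h i j
    simp only [List.map_cons, List.prod_cons, ih]
    rw [mul_assoc, ← mul_assoc (g i), hc.eq]
    simp only [mul_assoc]

/-- Telescoping: the terms of the expanded product other than ∏ G remain completely positive. -/
theorem isCP_list_prod_sub {ι : Type*} {A G : ι → SuperOp n} (hG : ∀ i, IsCP (G i))
    (hAG : ∀ i, IsCP (A i - G i)) (l : List ι) :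
    IsCP ((l.map A).prod - (l.map G).prod) := by
  induction l with
  | nil => simpa using IsCP.zero
  | cons i l ih =>
    have hA (j) : IsCP (A j) := by simpa using (hAG j).add (hG j)
    have h1 : IsCP (l.map A).prod := IsCP.list_prod fun Φ hΦ => by
      obtain ⟨j, -, rfl⟩ := List.mem_map.1 hΦ
      exact hA j
    have h2 : (A i - G i) * (l.map A).prod + G i * ((l.map A).prod - (l.map G).prod) =
        A i * (l.map A).prod - G i * (l.map G).prod := by
      rw [sub_mul, mul_sub, sub_add_sub_cancel]
    simp only [List.map_cons, List.prod_cons]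
    rw [← h2]
    exact ((hAG i).mul h1).add ((hG i).mul ih)

theorem trace_list_prod_apply {ι : Type*} {H : ι → SuperOp n} {c : ℂ}
    (h : ∀ i X, (H i X).trace = c * X.trace) (l : List ι) (X : Matrix n n ℂ) :
    ((l.map H).prod X).trace = c ^ l.length * X.trace := by
  induction l with
  | nil => simp
  | cons i l ih =>
    rw [List.map_cons, List.prod_cons, Module.End.mul_apply, h, ih, List.length_cons, pow_succ',
      mul_assoc]

/-- G - μ multiplies traces by -μ ≠ 0, while some power of it kills X. -/
theorem trace_eq_zero_of_mem_maxGenEigenspace {G : SuperOp n} (hG : ∀ X, (G X).trace = 0)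
    {μ : ℂ} (hμ : μ ≠ 0) {X : Matrix n n ℂ} (hX : X ∈ G.maxGenEigenspace μ) : X.trace = 0 := by
  obtain ⟨m, hm⟩ := (Module.End.mem_maxGenEigenspace _ _ _).1 hX
  have h (m : ℕ) : (((G - μ • (1 : SuperOp n)) ^ m) X).trace = (-μ) ^ m * X.trace := by
    induction m with
    | zero => simp
    | succ m ih =>
      rw [pow_succ', Module.End.mul_apply, LinearMap.sub_apply, Matrix.trace_sub, hG,
        LinearMap.smul_apply, Module.End.one_apply, Matrix.trace_smul, ih, smul_eq_mul]
      ring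
  have h1 := h m
  rw [hm, Matrix.trace_zero, eq_comm, mul_eq_zero] at h1
  exact h1.resolve_left (pow_ne_zero m (neg_ne_zero.2 hμ))

variable {K : ℕ} {E : Fin K → SuperOp n} {ρ : Matrix n n ℂ}

theorem trace_sum_sub_one (hE : ∀ k, IsCPTP (E k)) (X : Matrix n n ℂ) :
    ((∑ k, (E k - 1)) X).trace = 0 := by
  rw [LinearMap.sum_apply, Matrix.trace_sum]
  exact Finset.sum_eq_zero fun k _ => by
    rw [LinearMap.sub_apply, Matrix.trace_sub, (hE k).2, Module.End.one_apply, sub_self]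

theorem eq_of_forall_injective (hprod : ∀ σ, IsDensity σ → (List.ofFn E).prod σ = ρ)
    (hρ : IsDensity ρ) (hinj : ∀ k, Function.Injective (E k)) {σ : Matrix n n ℂ}
    (hσ : IsDensity σ) : σ = ρ := by
  have h (l : List (SuperOp n)) (hl : ∀ Φ ∈ l, Function.Injective Φ) :
      Function.Injective l.prod := by
    induction l with
    | nil => exact Function.injective_id
    | cons Φ l ih =>
      rw [List.prod_cons]
      exact (hl Φ (by simp)).comp (ih fun Ψ hΨ => hl Ψ (by simp [hΨ]))
  refine h (List.ofFn E) (fun Φ hΦ => ?_) ((hprod σ hσ).trans (hprod ρ hρ).symm)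
  obtain ⟨k, rfl⟩ := (List.mem_ofFn' _ _).1 hΦ
  exact hinj k

variable [DecidableEq n]

/-- If a composition of commuting channels prepares `ρ`, then `e^{tG}`, `G = ∑ k, (E k - 1)`, is
the sum of a completely positive map and of `(1 - e^{-t}) ^ K` times the preparation of `ρ`. -/
theorem exists_semigroup_decomposition (hE : ∀ k, IsCPTP (E k))
    (hcomm : ∀ j k, Commute (E j) (E k))
    (hprod : ∀ σ, IsDensity σ → (List.ofFn E).prod σ = ρ) {t : ℝ} (ht : 0 ≤ t) :
    ∃ R : SuperOp n, IsCP R ∧ ∀ X, semigroup (∑ k, (E k - 1)) t X =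
      R X + ((1 - Real.exp (-t) : ℝ) ^ K * X.trace : ℂ) • ρ := by
  set q : ℝ := Real.exp (-t) with hq
  have hq0 : (0 : ℂ) ≤ (q : ℂ) := by exact_mod_cast (Real.exp_pos _).le
  choose H hH hHc using fun k => exists_semigroup_eq_one_add_mul (E k) t
  let A (k : Fin K) : SuperOp n := semigroup (E k - 1) t
  -- The part of A k in which E k has acted at least once.
  let G (k : Fin K) : SuperOp n := (q : ℂ) • (semigroup (E k) t - 1)
  have hAG (k) : A k = (q : ℂ) • 1 + G k := by
    simp only [A, G, semigroup_sub_one, smul_sub, hq]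
    abel
  have hGE : G = fun k => E k * ((q : ℂ) • H k) := by
    ext1 k
    simp only [G, hH, add_sub_cancel_left, mul_smul_comm]
  -- E k preserves traces, so q H k changes them as G k = A k - q·1 does.
  have htr (k) (X : Matrix n n ℂ) :
      (((q : ℂ) • H k) X).trace = ((1 - q : ℝ) : ℂ) * X.trace := by
    have h1 : (A k X).trace = X.trace :=
      trace_semigroup_apply (fun X => by simp [(hE k).2]) t X
    have h2 : (G k X).trace = (((q : ℂ) • H k) X).trace := by
      rw [hGE, Module.End.mul_apply, (hE k).2]
    rw [hAG, LinearMap.add_apply, Matrix.trace_add, h2] at h1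
    simp only [LinearMap.smul_apply, Matrix.trace_smul, Module.End.one_apply, smul_eq_mul] at h1 ⊢
    push_cast
    linear_combination h1
  have hsemi : semigroup (∑ k, (E k - 1)) t = ((List.finRange K).map A).prod := by
    have h1 : ∑ k, (E k - 1) = ((List.finRange K).map fun k => E k - 1).sum := by
      rw [← List.ofFn_eq_map, List.sum_ofFn]
    rw [h1, semigroup_list_sum, List.map_map]
    · rfl
    · intro Φ hΦ Ψ hΨ
      obtain ⟨j, -, rfl⟩ := List.mem_map.1 hΦ
      obtain ⟨k, -, rfl⟩ := List.mem_map.1 hΨ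
      exact ((hcomm j k).sub_left (Commute.one_left _)).sub_right (Commute.one_right _)
  refine ⟨((List.finRange K).map A).prod - ((List.finRange K).map G).prod,
    isCP_list_prod_sub (fun k => (IsCP.semigroup_sub_one (hE k).1 ht).smul hq0)
      (fun k => ?_) _, fun X => ?_⟩
  · rw [hAG, add_sub_cancel_right]
    exact IsCP.one.smul hq0
  · have h1 : ((List.finRange K).map G).prod X =
        (((1 - q : ℝ) : ℂ) ^ K * X.trace) • ρ := by
      rw [hGE, list_prod_map_mul fun i j => (hHc i _ (hcomm i j)).smul_left _, ← List.ofFn_eq_map,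
        Module.End.mul_apply, apply_eq_trace_smul hprod, trace_list_prod_apply htr,
        List.length_finRange]
    rw [hsemi, ← h1, LinearMap.sub_apply, sub_add_cancel]

/-- The part of the semigroup that has not reached `ρ` has small trace. -/
theorem exists_remainder (hE : ∀ k, IsCPTP (E k))
    (hcomm : ∀ j k, Commute (E j) (E k)) (hρ : ρ.trace = 1)
    (hprod : ∀ σ, IsDensity σ → (List.ofFn E).prod σ = ρ) {t : ℝ} (ht : 0 ≤ t) :
    ∃ (R : SuperOp n) (p : ℝ), IsCP R ∧ 0 ≤ p ∧ p ≤ K * Real.exp (-t) ∧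
      (∀ X, (R X).trace = p * X.trace) ∧
      ∀ X, semigroup (∑ k, (E k - 1)) t X = R X + ((1 - p : ℝ) * X.trace : ℂ) • ρ := by
  obtain ⟨R, hR, h⟩ := exists_semigroup_decomposition hE hcomm hprod ht
  have hq : Real.exp (-t) ≤ 1 := Real.exp_le_one_iff.2 (by linarith)
  refine ⟨R, 1 - (1 - Real.exp (-t)) ^ K, hR, ?_, ?_, fun X => ?_, fun X => ?_⟩
  · exact sub_nonneg.2 (pow_le_one₀ (by linarith) (by linarith [Real.exp_pos (-t)]))
  -- Bernoulli's inequality, in effect a union bound over the K clocks.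
  · have := one_add_mul_le_pow (a := -Real.exp (-t)) (by linarith) K
    rw [← sub_eq_add_neg] at this
    linarith
  · have h1 := congrArg Matrix.trace (h X)
    rw [trace_semigroup_apply (trace_sum_sub_one hE), Matrix.trace_add, Matrix.trace_smul, hρ,
      smul_eq_mul, mul_one] at h1
    push_cast at h1 ⊢
    linear_combination -h1
  · rw [h X]
    push_cast
    simp

theorem traceNorm_semigroup_sub_le (hE : ∀ k, IsCPTP (E k))
    (hcomm : ∀ j k, Commute (E j) (E k)) (hρ : IsDensity ρ)
    (hprod : ∀ σ, IsDensity σ → (List.ofFn E).prod σ = ρ) {t : ℝ} (ht : 0 ≤ t)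
    {σ : Matrix n n ℂ} (hσ : IsDensity σ) :
    traceNorm (semigroup (∑ k, (E k - 1)) t σ - ρ) ≤ 2 * (K * Real.exp (-t)) := by
  obtain ⟨R, p, hR, hp0, hp, htr, h⟩ := exists_remainder hE hcomm hρ.2 hprod ht
  have h1 : semigroup (∑ k, (E k - 1)) t σ - ρ = R σ - (p : ℂ) • ρ := by
    rw [h, hσ.2]
    push_cast
    module
  rw [h1]
  refine (traceNorm_sub_le (hR.posSemidef hσ.1)
    (hρ.1.smul (by exact_mod_cast hp0))).trans ?_
  rw [htr, Matrix.trace_smul, hσ.2, hρ.2]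
  simp
  linarith

theorem isCPTP_semigroup (hE : ∀ k, IsCPTP (E k))
    (hcomm : ∀ j k, Commute (E j) (E k))
    (hprod : ∀ σ, IsDensity σ → (List.ofFn E).prod σ = ρ) {t : ℝ} (ht : 0 ≤ t) :
    IsCPTP (semigroup (∑ k, (E k - 1)) t) := by
  obtain ⟨R, hR, h⟩ := exists_semigroup_decomposition hE hcomm hprod ht
  refine ⟨?_, trace_semigroup_apply (trace_sum_sub_one hE) t⟩
  have h1 : semigroup (∑ k, (E k - 1)) t =
      R + (((1 - Real.exp (-t)) ^ K : ℝ) : ℂ) • (List.ofFn E).prod := by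
    refine LinearMap.ext fun X => ?_
    rw [h, LinearMap.add_apply, LinearMap.smul_apply, apply_eq_trace_smul hprod, smul_smul]
    push_cast
    rfl
  rw [h1]
  refine hR.add (IsCP.smul (IsCP.list_prod fun Φ hΦ => ?_) ?_)
  · obtain ⟨k, rfl⟩ := (List.mem_ofFn' _ _).1 hΦ
    exact (hE k).1
  · have : (0 : ℝ) ≤ (1 - Real.exp (-t)) ^ K :=
      pow_nonneg (sub_nonneg.2 (Real.exp_le_one_iff.2 (by linarith))) K
    exact_mod_cast this

/-- For traceless X the preparation term drops out, so e^{tμ}X = RX with |e^{tμ}| = 1, while R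
shrinks the trace norm once t is large. -/
theorem eq_zero_of_trace_eq_zero_of_eigenvector (hE : ∀ k, IsCPTP (E k))
    (hcomm : ∀ j k, Commute (E j) (E k)) (hρ : IsDensity ρ)
    (hprod : ∀ σ, IsDensity σ → (List.ofFn E).prod σ = ρ) {X : Matrix n n ℂ}
    (hX : X.trace = 0) {μ : ℂ} (hμ : μ.re = 0) (h : (∑ k, (E k - 1)) X = μ • X) : X = 0 := by
  -- The four-term decomposition gives ‖RX‖₁ ≤ 2p‖X‖₁, so any p below 1/2 would do.
  obtain ⟨t, ht0, ht⟩ : ∃ t : ℝ, 0 ≤ t ∧ K * Real.exp (-t) < 1 / 4 := by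
    have h1 : Filter.Tendsto (fun t : ℝ => K * Real.exp (-t)) Filter.atTop (nhds (K * 0)) :=
      Real.tendsto_exp_neg_atTop_nhds_zero.const_mul _
    rw [mul_zero] at h1
    exact ((Filter.eventually_ge_atTop 0).and
      (h1.eventually_lt_const (by norm_num : (0 : ℝ) < 1 / 4))).exists
  obtain ⟨R, p, hR, hp0, hp, htr, hRX⟩ := exists_remainder hE hcomm hρ.2 hprod ht0
  have h1 := hRX X
  rw [semigroup_apply_of_eigenvector h, hX, mul_zero, zero_smul, add_zero] at h1
  obtain ⟨P, hP, hXP, hPtr⟩ := exists_posSemidef_decomposition X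
  have h2 : X = ∑ k : Fin 4, (Complex.exp (-(t * μ)) * Complex.I ^ (k : ℕ)) • R (P k) := by
    simp only [mul_smul, ← Finset.smul_sum, ← map_smul, ← map_sum]
    rw [← hXP, map_smul, ← h1, smul_smul, ← Complex.exp_add, neg_add_cancel, Complex.exp_zero,
      one_smul]
  have h3 : traceNorm X ≤ p * (2 * traceNorm X) := by
    conv_lhs => rw [h2]
    refine (traceNorm_sum_smul_le _ _ fun k _ => hR.posSemidef (hP k)).trans (le_of_eq ?_)
    rw [← hPtr, Finset.mul_sum]
    refine Finset.sum_congr rfl fun k _ => ?_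
    rw [htr]
    simp [Complex.norm_exp, hμ]
  have h4 := traceNorm_nonneg X
  exact eq_zero_of_traceNorm_eq_zero (by nlinarith)

theorem eq_zero_of_trace_eq_zero_of_mem_maxGenEigenspace (hE : ∀ k, IsCPTP (E k))
    (hcomm : ∀ j k, Commute (E j) (E k)) (hρ : IsDensity ρ)
    (hprod : ∀ σ, IsDensity σ → (List.ofFn E).prod σ = ρ) {X : Matrix n n ℂ}
    (hX : X.trace = 0) {μ : ℂ} (hμ : μ.re = 0)
    (h : X ∈ Module.End.maxGenEigenspace (∑ k, (E k - 1)) μ) : X = 0 := by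
  obtain ⟨m, hm⟩ := Module.End.mem_maxGenEigenspace _ _ _ |>.1 h
  clear h
  induction m generalizing X with
  | zero => simpa using hm
  | succ m ih =>
    rw [pow_succ, Module.End.mul_apply] at hm
    have h1 := ih (by
      rw [LinearMap.sub_apply, Matrix.trace_sub, trace_sum_sub_one hE]
      simp [hX]) hm
    refine eq_zero_of_trace_eq_zero_of_eigenvector hE hcomm hρ hprod hX hμ ?_
    rwa [LinearMap.sub_apply, sub_eq_zero] at h1

/-- Generalized eigenvectors for nonzero eigenvalues are traceless, and traceless peripheral ones
vanish. So the peripheral space lies in the span of ρ and its complement in the kernel of the trace,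
which fixes the projection. -/
theorem isUniqueEquilibrium (hE : ∀ k, IsCPTP (E k))
    (hcomm : ∀ j k, Commute (E j) (E k)) (hρ : IsDensity ρ)
    (hprod : ∀ σ, IsDensity σ → (List.ofFn E).prod σ = ρ) (hinv : ∀ k, E k ρ = ρ) :
    IsUniqueEquilibrium (∑ k, (E k - 1)) ρ := by
  set G := ∑ k, (E k - 1) with hG
  have hGρ : G ρ = 0 := by simp [hG, LinearMap.sum_apply, hinv]
  have hgen {X : Matrix n n ℂ} (hX : G X = 0) : X ∈ G.maxGenEigenspace 0 :=
    (Module.End.mem_maxGenEigenspace _ _ _).2 ⟨1, by simpa using hX⟩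
  have hker {X : Matrix n n ℂ} (hX : G X = 0) : X ∈ peripheralSpace G :=
    (le_iSup₂_of_le (f := fun (μ : ℂ) (_ : μ ∈ {μ : ℂ | μ.re = 0}) => G.maxGenEigenspace μ)
      (0 : ℂ) Complex.zero_re le_rfl : G.maxGenEigenspace 0 ≤ peripheralSpace G) (hgen hX)
  have hper : peripheralSpace G ≤ Submodule.span ℂ {ρ} := by
    refine iSup₂_le fun μ hμ X hX => ?_
    have h0 : X.trace = 0 ∨ μ = 0 := by
      by_contra! h0
      exact h0.1 (trace_eq_zero_of_mem_maxGenEigenspace (trace_sum_sub_one hE) h0.2 hX)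
    rcases h0 with h0 | rfl
    · rw [eq_zero_of_trace_eq_zero_of_mem_maxGenEigenspace hE hcomm hρ hprod h0 hμ hX]
      exact zero_mem _
    · have h1 : (X - X.trace • ρ).trace = 0 := by
        rw [Matrix.trace_sub, Matrix.trace_smul, hρ.2, smul_eq_mul, mul_one, sub_self]
      have h2 := eq_zero_of_trace_eq_zero_of_mem_maxGenEigenspace hE hcomm hρ hprod h1 hμ
        (Submodule.sub_mem _ hX (Submodule.smul_mem _ _ (hgen hGρ)))
      rw [sub_eq_zero.1 h2]
      exact Submodule.smul_mem _ _ (Submodule.mem_span_singleton_self ρ)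
  have hnon : nonperipheralSpace G ≤ LinearMap.ker (Matrix.traceLinearMap n ℂ ℂ) := by
    refine iSup₂_le fun μ hμ X hX => ?_
    refine trace_eq_zero_of_mem_maxGenEigenspace (trace_sum_sub_one hE) ?_ hX
    rintro rfl
    exact hμ rfl
  have hproj (X : Matrix n n ℂ) : peripheralProj G X = X.trace • ρ := by
    obtain ⟨c, hc⟩ := Submodule.mem_span_singleton.1
      (hper (Submodule.projection_apply_mem (isCompl_peripheralSpace G) X))
    have h1 : (X - peripheralProj G X).trace = 0 :=
      hnon (Submodule.sub_projection_mem (isCompl_peripheralSpace G) X)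
    have h2 : peripheralProj G X = c • ρ := hc.symm
    rw [h2, Matrix.trace_sub, Matrix.trace_smul, hρ.2, smul_eq_mul, mul_one, sub_eq_zero] at h1
    rw [h2, h1]
  refine ⟨hGρ, fun σ hσ h => ?_, hproj⟩
  have h1 := hproj σ
  rw [hσ.2, one_smul] at h1
  rw [← h1]
  exact (Submodule.projection_apply_of_mem_left (isCompl_peripheralSpace G) (hker h)).symm

/-- The contraction coefficient is at most `K e^{-t}` in general. It vanishes if `ν > 1`, since the
maps `E k` are then injective and there is a single density operator. -/
theorem contractionCoeff_le (hE : ∀ k, IsCPTP (E k))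
    (hcomm : ∀ j k, Commute (E j) (E k)) (hρ : IsDensity ρ)
    (hprod : ∀ σ, IsDensity σ → (List.ofFn E).prod σ = ρ) (hinv : ∀ k, E k ρ = ρ)
    {ν : ℝ} (hgap : ∀ k (μ : ℂ), (E k).HasEigenvalue μ → μ = 1 ∨ ‖μ‖ < 1 - ν)
    {t : ℝ} (ht : 0 ≤ t) :
    contractionCoeff (∑ k, (E k - 1)) t ≤ K * Real.exp (-ν * t) := by
  have h0 : 0 ≤ K * Real.exp (-ν * t) := by positivity
  suffices h : sSup {r : ℝ | ∃ σ : Matrix n n ℂ, IsDensity σ ∧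
      r = traceNorm (semigroup (∑ k, (E k - 1)) t σ -
        peripheralProj (∑ k, (E k - 1)) (semigroup (∑ k, (E k - 1)) t σ))} ≤
      2 * (K * Real.exp (-ν * t)) by
    rw [contractionCoeff]
    linarith
  refine Real.sSup_le ?_ (by linarith)
  rintro _ ⟨σ, hσ, rfl⟩
  have hCP := isCPTP_semigroup hE hcomm hprod ht
  have hσt : IsDensity (semigroup (∑ k, (E k - 1)) t σ) :=
    ⟨IsCP.posSemidef hCP.1 hσ.1, (hCP.2 σ).trans hσ.2⟩
  rw [(isUniqueEquilibrium hE hcomm hρ hprod hinv).peripheral, hσt.2, one_smul]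
  by_cases hν : ν ≤ 1
  -- The rate here is 1, and e^{-t} ≤ e^{-νt} for ν ≤ 1.
  · refine (traceNorm_semigroup_sub_le hE hcomm hρ hprod ht hσ).trans ?_
    gcongr
    nlinarith
  · have hinj (k) : Function.Injective (E k) := by
      rw [← LinearMap.ker_eq_bot]
      by_contra h
      rw [← Module.End.eigenspace_zero] at h
      rcases hgap k 0 h with h1 | h1
      · exact zero_ne_one h1
      · rw [norm_zero] at h1
        linarith
    rw [eq_of_forall_injective hprod hρ hinj hσt, sub_self, traceNorm_zero]
    linarith

end Preparation

/-! ### Application to the scalable family -/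

theorem isDensity_pureState {n : Type} [Fintype n] {ψ : EuclideanSpace ℂ n} (h : ‖ψ‖ = 1) :
    IsDensity (pureState ψ) := by
  refine ⟨Matrix.posSemidef_vecMulVec_self_star (R := ℂ) (ψ : n → ℂ), ?_⟩
  have h1 : (pureState ψ).trace = inner ℂ ψ ψ := by
    rw [PiLp.inner_apply]
    rfl
  rw [h1, inner_self_eq_norm_sq_to_K, h]
  simp

end QLMixing

end

theorem mainTheorem11 (F : QLMixing.ScalableFamily)
    (E : (s : ℕ) → Fin (F.K s) → QLMixing.SuperOp (QLMixing.Config (F.N s) F.d))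
    (hRFTS : ∀ s, QLMixing.MadeRFTSBy (F.nbhd s) (F.ψ s) (E s))
    (hcomm : ∀ s j k, Commute (E s j) (E s k))
    (ν : ℝ) (hν : 0 < ν)
    (hgap : ∀ s k (μ : ℂ), Module.End.HasEigenvalue (E s k) μ → μ = 1 ∨ ‖μ‖ < 1 - ν) :
    (∃ C : ℝ, ∀ s, QLMixing.IsBoundedQLLiouvillian (F.nbhd s) C (∑ k, (E s k - 1))) ∧
    ∃ c : ℝ, QLMixing.IsRapidlyMixing F (fun s => ∑ k, (E s k - 1)) c 1 ν := by
  have hE (s k) : QLMixing.IsCPTP (E s k) := ((hRFTS s).neighborhoodMap k).isCPTP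
  have hρ (s) := QLMixing.isDensity_pureState (F.norm_ψ s)
  have hprod (s σ) (hσ : QLMixing.IsDensity σ) :
      (List.ofFn (E s)).prod σ = QLMixing.pureState (F.ψ s) :=
    (hRFTS s).attractive 1 σ hσ
  obtain ⟨b, hb, hK⟩ := F.card_nbhds
  -- The prefactor c is the constant b in K ≤ bN.
  refine ⟨⟨4, fun s => ⟨fun k => E s k - 1, rfl, fun k =>
    ⟨((hRFTS s).neighborhoodMap k).isNeighborhoodLiouvillian, (hE s k).traceNorm_sub_le⟩⟩⟩, b, ?_⟩
  refine ⟨hb, one_pos, hν, fun s t ht => ?_, fun s => ?_, fun s t ht => ?_⟩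
  · exact QLMixing.isCPTP_semigroup (hE s) (hcomm s) (hprod s) ht
  · exact QLMixing.isUniqueEquilibrium (hE s) (hcomm s) (hρ s) (hprod s) (hRFTS s).invariant
  · refine (QLMixing.contractionCoeff_le (hE s) (hcomm s) (hρ s) (hprod s) (hRFTS s).invariant
      (hgap s) ht).trans ?_
    rw [Real.rpow_one]
    exact mul_le_mul_of_nonneg_right (hK s) (Real.exp_pos _).le
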